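/- Let $S$ be a finite non-empty set and let $r(x,y)>0$ for all $x\ne y$ in $S$. Let $(d_N)_{N\ge 1}$ be a sequence of positive real numbers with $$\lim_{N\to\infty} d_N\,N^{|S|+2}(\log N)^{|S|-3}=0 .$$ For $N\ge 1$ put $\mathcal H_N=\{\eta\in\{0,1,2,\dots\}^S:\sum_{x\in S}\eta_x=N\}$. The inclusion process is the continuous-time Markov chain on $\mathcal H_N$ with generator $$(\mathcal L_NF)(\eta)=\sum_{x,y\in S,\ x\ne y}\eta_x(d_N+\eta_y)\,r(x,y)\,\{F(\sigma^{x,y}\eta)-F(\eta)\},\qquad F:\mathcal H_N\to\mathbb R,$$ where $\sigma^{x,y}\eta$ is obtained from $\eta$ by moving one particle from $x$ to $y$ if $\eta_x\ge 1$, and $\sigma^{x,y}\eta=\eta$ if $\eta_x=0$. For every $N\ge 1$ this process has a unique invariant probability measure $\mu_N$ on $\mathcal H_N$, that is, a unique probability measure with $\sum_{\eta}\mu_N(\eta)(\mathcal L_NF)(\eta)=0$ for all $F$. Let $\mathcal E_N=\{\eta\in\mathcal H_N:\eta_x=N\text{ for some }x\in S\}$ be the set of condensed configurations. Then condensation occurs: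 $$\lim_{N\to\infty}\mu_N(\mathcal E_N)=1 .$$ -/

import Mathlib

open Filter Topology

namespace InclusionProcess

/-- The configurations of `N` particles on the finite set `S`: functions `η : S → ℕ` with
`∑ x, η x = N`. -/
abbrev Config (S : Type*) [Fintype S] (N : ℕ) : Type _ :=
  {η : S → ℕ // ∑ x, η x = N}

instance (S : Type*) [Fintype S] [DecidableEq S] (N : ℕ) : Fintype (Config S N) :=
  Fintype.subtype (Finset.piAntidiag Finset.univ N) (by intro η; simp)

theorem sum_move {S : Type*} [Fintype S] [DecidableEq S] (x y : S) (η : S → ℕ)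
    (h : x ≠ y ∧ 1 ≤ η x) :
    ∑ z, (if z = x then η x - 1 else if z = y then η y + 1 else η z) = ∑ z, η z := by
  obtain ⟨hxy, hx⟩ := h
  have hy : y ∈ Finset.univ.erase x := Finset.mem_erase.2 ⟨hxy.symm, Finset.mem_univ y⟩
  rw [← Finset.add_sum_erase _ _ (Finset.mem_univ x), ← Finset.add_sum_erase _ _ hy,
    ← Finset.add_sum_erase _ η (Finset.mem_univ x), ← Finset.add_sum_erase _ η hy]
  have hrest : ∑ z ∈ (Finset.univ.erase x).erase y,
      (if z = x then η x - 1 else if z = y then η y + 1 else η z)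
      = ∑ z ∈ (Finset.univ.erase x).erase y, η z := by
    refine Finset.sum_congr rfl fun z hz => ?_
    simp only [Finset.mem_erase] at hz
    simp [hz.1, hz.2.1]
  rw [hrest]
  simp only [if_true, hxy.symm, if_false]
  omega

/-- The configuration obtained from `η` by sending one particle from `x` to `y`; it is `η` itself
if there is no particle at `x` (or if `x = y`). -/
def move {S : Type*} [Fintype S] [DecidableEq S] {N : ℕ} (x y : S) (η : Config S N) :
    Config S N :=
  if h : x ≠ y ∧ 1 ≤ η.1 x then
    ⟨fun z => if z = x then η.1 x - 1 else if z = y then η.1 y + 1 else η.1 z,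
      (sum_move x y η.1 h).trans η.2⟩
  else η

/-- The generator of the inclusion process with `N` particles, jump rates `r` of the underlying
random walk and diffusion parameter `d`:
`(L F)(η) = ∑_{x ≠ y} η_x (d + η_y) r(x, y) (F(move x y η) - F(η))`. -/
def generator {S : Type*} [Fintype S] [DecidableEq S] (r : S → S → ℝ) (d : ℝ) {N : ℕ}
    (F : Config S N → ℝ) (η : Config S N) : ℝ :=
  ∑ x, ∑ y ∈ Finset.univ.erase x,
    (η.1 x : ℝ) * (d + (η.1 y : ℝ)) * r x y * (F (move x y η) - F η)

/-- `m` is (the mass function of) an invariant probability measure of the inclusion process: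
it is a probability vector on the configurations and `∫ L F dm = 0` for every function `F`. -/
def IsInvariantProbability {S : Type*} [Fintype S] [DecidableEq S] (r : S → S → ℝ) (d : ℝ)
    {N : ℕ} (m : Config S N → ℝ) : Prop :=
  m ∈ stdSimplex ℝ (Config S N) ∧
    ∀ F : Config S N → ℝ, ∑ η, m η * generator r d F η = 0

/-- The condensed configurations: all `N` particles are located at one site. -/
def condensed (S : Type*) [Fintype S] [DecidableEq S] (N : ℕ) : Finset (Config S N) :=
  Finset.univ.filter fun η => ∃ x, η.1 x = N

end InclusionProcess

/-!
Write the generator as `d` times a diffusive part plus an inclusion part with rates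
`η x * η y * r x y`. The inclusion part does not move condensed configurations. It therefore
suffices to find a function `F` on which the inclusion part is at most `-c / N` off the condensed
configurations and whose oscillation is at most `T`: the diffusive part contributes at most
`d * N * R * T`, and integrating the generator applied to `F` against the invariant measure gives
mass at most `d * N ^ 2 * R * T / c` to the configurations that are not condensed.

While the set `B` of occupied sites does not change, the inclusion part follows, to first order,
the replicator equation of the symmetric zero-sum game in which `x` earns `r y x - r x y` against
`y`. The game with the opposite payoffs has an optimal mixed strategy `p` on `B`
(`exists_optimal_strategy`), and optimality says exactly that `∑ x, p x * log (η x)` has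
nonpositive first order drift, whatever the configuration on `B`. Its second order drift is
strictly negative, because the logarithm is concave; with harmonic sums in place of logarithms both
statements become exact inequalities (`mul_potential_move_sub_le`). The strategy depends on `B`, so
the function `F` is glued from these weighted sums by adding `N + 2` for every occupied site. Then
`T` is of order `N`, and the mass off the condensed configurations is `O(d * N ^ 3)`
(`exists_one_sub_condensed_le`), which tends to zero by assumption if there are at least two sites.

Both the optimal strategies and the existence of the invariant measure come from Ville's theorem
of the alternative; for the latter the alternative is excluded by the maximum principle. The
invariant measure is unique since the chain is irreducible.
-/

/-! ### A theorem of the alternative and optimal strategies -/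

open Matrix in
/-- Ville's theorem of the alternative: if no nonnegative row vector `q` makes all entries of
`q ᵥ* A` positive, then some probability vector `p` satisfies `A *ᵥ p ≤ 0`. -/
theorem exists_mem_stdSimplex_mulVec_nonpos {m n : Type*} [Fintype m] [Fintype n]
    (A : Matrix m n ℝ) (h : ∀ q : m → ℝ, 0 ≤ q → ∃ j, (q ᵥ* A) j ≤ 0) :
    ∃ p ∈ stdSimplex ℝ n, A *ᵥ p ≤ 0 := by
  classical
  by_contra! hcon
  have hK : IsCompact (A.mulVecLin '' stdSimplex ℝ n) :=
    (isCompact_stdSimplex ℝ n).image A.mulVecLin.continuous_of_finiteDimensional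
  have hdisj : Disjoint (Set.Iic (0 : m → ℝ)) (A.mulVecLin '' stdSimplex ℝ n) := by
    rw [Set.disjoint_left]
    rintro _ hz ⟨p, hp, rfl⟩
    exact hcon p hp hz
  obtain ⟨f, u, v, hu, huv, hv⟩ := geometric_hahn_banach_closed_compact (convex_Iic (0 : m → ℝ))
    isClosed_Iic ((convex_stdSimplex ℝ n).linear_image _) hK hdisj
  have hu0 : 0 < u := by simpa using hu 0 (Set.mem_Iic.2 le_rfl)
  have hf : ∀ z, f z = ∑ i, f (Pi.single i 1) * z i := by
    intro z
    conv_lhs => rw [pi_eq_sum_univ' z, map_sum]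
    refine Finset.sum_congr rfl fun i _ => ?_
    rw [map_smul, smul_eq_mul, mul_comm]
  obtain ⟨j, hj⟩ := h (fun i => f (Pi.single i 1)) (by
    intro i
    by_contra! hi
    simp only [Pi.zero_apply] at hi
    have h1 := hu (Pi.single i (u / f (Pi.single i 1))) (by
      rw [Set.mem_Iic, Pi.single_nonpos]
      exact div_nonpos_of_nonneg_of_nonpos hu0.le hi.le)
    rw [hf, Finset.sum_eq_single i (by intro b _ hb; simp [hb]) (by simp)] at h1
    rw [Pi.single_eq_same, mul_div_cancel₀ _ hi.ne] at h1
    exact lt_irrefl _ h1)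
  have h2 := hv _ ⟨_, single_mem_stdSimplex ℝ j, rfl⟩
  rw [hf] at h2
  simp only [Matrix.vecMul, dotProduct] at hj
  simp only [Matrix.mulVecLin_apply, Matrix.mulVec_single_one, Matrix.col_apply] at h2
  linarith

/-- A symmetric zero-sum game restricted to the pure strategies in `B` has an optimal mixed
strategy; the payoff of `x` against `y` is `r x y - r y x`. -/
theorem exists_optimal_strategy {S : Type*} [Fintype S] [DecidableEq S] (r : S → S → ℝ)
    (B : Finset S) (hB : B.Nonempty) :
    ∃ p ∈ stdSimplex ℝ S, (∀ x ∉ B, p x = 0) ∧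
      ∀ x ∈ B, ∑ y, (r x y - r y x) * p y ≤ 0 := by
  have hne : Nonempty B := hB.to_subtype
  obtain ⟨q, hq, hA⟩ := exists_mem_stdSimplex_mulVec_nonpos
    (Matrix.of fun x y : B => r x y - r y x) (by
      intro q hq
      by_contra! hpos
      simp only [Matrix.vecMul, dotProduct, Matrix.of_apply] at hpos
      have hzero : ∑ j : B, (∑ i : B, q i * (r i j - r j i)) * q j = 0 := by
        have hswap : ∑ j : B, (∑ i : B, q i * (r i j - r j i)) * q j
            = -∑ j : B, (∑ i : B, q i * (r i j - r j i)) * q j := by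
          conv_lhs => simp only [Finset.sum_mul]
          conv_rhs => simp only [Finset.sum_mul]
          conv_lhs => rw [Finset.sum_comm]
          rw [← Finset.sum_neg_distrib]
          refine Finset.sum_congr rfl fun i _ => ?_
          rw [← Finset.sum_neg_distrib]
          exact Finset.sum_congr rfl fun j _ => by ring
        linarith
      rw [Finset.sum_eq_zero_iff_of_nonneg
        (fun j _ => mul_nonneg (hpos j).le (hq j))] at hzero
      have hq0 : ∀ j, q j = 0 := fun j =>
        (mul_eq_zero.1 (hzero j (Finset.mem_univ j))).resolve_left (hpos j).ne'
      obtain ⟨j⟩ := hne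
      simpa [hq0] using hpos j)
  have key : ∀ f : S → ℝ, ∑ y, f y * (if h : y ∈ B then q ⟨y, h⟩ else 0)
      = ∑ y : B, f y * q y := by
    intro f
    rw [← Finset.sum_subset (Finset.subset_univ B) (by intro y _ hy; simp [hy]),
      ← Finset.sum_coe_sort B]
    exact Finset.sum_congr rfl fun y _ => by simp
  refine ⟨fun y => if h : y ∈ B then q ⟨y, h⟩ else 0, ⟨fun y => ?_, ?_⟩, ?_, ?_⟩
  · dsimp only
    split_ifs
    exacts [hq.1 _, le_rfl]
  · simpa only [Pi.one_apply, one_mul, hq.2] using key 1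
  · intro x hx
    simp [hx]
  · intro x hx
    rw [key]
    exact hA ⟨x, hx⟩

/-! ### Existence and uniqueness of the invariant measure -/

namespace InclusionProcess

theorem Config.apply_le {S : Type*} [Fintype S] {N : ℕ} (η : Config S N) (x : S) : η.1 x ≤ N :=
  (Finset.single_le_sum (fun _ _ => Nat.zero_le _) (Finset.mem_univ x)).trans_eq η.2

theorem rate_nonneg {S : Type*} [Fintype S] {N : ℕ} {r : S → S → ℝ} {d : ℝ}
    (hr : ∀ x y : S, x ≠ y → 0 < r x y) (hd : 0 < d)
    (η : Config S N) {x y : S}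
    (hxy : x ≠ y) : 0 ≤ (η.1 x : ℝ) * (d + (η.1 y : ℝ)) * r x y := by
  have := (hr x y hxy).le
  positivity

variable {S : Type*} [Fintype S] [DecidableEq S] {N : ℕ}

theorem move_val {x y : S} (hxy : x ≠ y) {η : Config S N} (hx : 1 ≤ η.1 x) (z : S) :
    (move x y η).1 z = if z = x then η.1 x - 1 else if z = y then η.1 y + 1 else η.1 z := by
  simp [move, hxy, hx]

theorem move_move {x y : S} (hxy : x ≠ y) {η : Config S N} (hx : 1 ≤ η.1 x) :
    move y x (move x y η) = η := by
  ext z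
  rw [move_val hxy.symm (by simp [move_val hxy hx, hxy.symm])]
  simp only [move_val hxy hx]
  split_ifs <;> grind

/-- Particle jumps connect any two configurations: a set of configurations that is closed under
them contains all configurations or none. -/
theorem mem_of_closed_under_move {Z : Set (Config S N)}
    (hZ : ∀ η ∈ Z, ∀ x y : S, x ≠ y → 1 ≤ η.1 x → move x y η ∈ Z) {η : Config S N} (hη : η ∈ Z)
    (ζ : Config S N) : ζ ∈ Z := by
  induction hn : ∑ z, (η.1 z - ζ.1 z) using Nat.strong_induction_on generalizing η with
  | _ n ih =>
    by_cases hle : ∀ z, η.1 z ≤ ζ.1 z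
    · have hsum : ∑ z, η.1 z = ∑ z, ζ.1 z := η.2.trans ζ.2.symm
      rw [Finset.sum_eq_sum_iff_of_le fun z _ => hle z] at hsum
      have : η = ζ := Subtype.ext (funext fun z => hsum z (Finset.mem_univ z))
      exact this ▸ hη
    · push Not at hle
      obtain ⟨x, hx⟩ := hle
      obtain ⟨y, hy⟩ : ∃ y, η.1 y < ζ.1 y := by
        by_contra! hcon
        have := Finset.sum_lt_sum (fun z _ => hcon z) ⟨x, Finset.mem_univ x, hx⟩
        rw [η.2, ζ.2] at this
        exact lt_irrefl _ this
      have hxy : x ≠ y := by rintro rfl; omega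
      have hx1 : 1 ≤ η.1 x := by omega
      refine ih _ ?_ (hZ η hη x y hxy hx1) rfl
      rw [← hn]
      refine Finset.sum_lt_sum (fun z _ => ?_) ⟨x, Finset.mem_univ x, ?_⟩
      · rw [move_val hxy hx1]
        split_ifs <;> grind
      · rw [move_val hxy hx1, if_pos rfl]
        omega

section Generator

variable {r : S → S → ℝ} {d : ℝ}

theorem generator_eq_sum_apply_single (F : Config S N → ℝ) (η : Config S N) :
    generator r d F η = ∑ ζ, F ζ * generator r d (Pi.single ζ 1) η := by
  have hF : ∀ ξ, F ξ = ∑ ζ, F ζ * (Pi.single ζ 1 : Config S N → ℝ) ξ := by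
    intro ξ
    simp [Pi.single_apply]
  simp only [generator, Finset.mul_sum]
  rw [Finset.sum_comm]
  refine Finset.sum_congr rfl fun x _ => ?_
  rw [Finset.sum_comm]
  refine Finset.sum_congr rfl fun y _ => ?_
  rw [hF (move x y η), hF η, ← Finset.sum_sub_distrib, Finset.mul_sum]
  exact Finset.sum_congr rfl fun ζ _ => by ring

open Matrix in
theorem exists_isInvariantProbability [Nonempty S] (hr : ∀ x y : S, x ≠ y → 0 < r x y)
    (hd : 0 < d) : ∃ m : Config S N → ℝ, IsInvariantProbability r d m := by
  have hne : Nonempty (Config S N) :=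
    ⟨⟨Pi.single (Classical.arbitrary S) N, by simp⟩⟩
  obtain ⟨m, hm, hle⟩ := exists_mem_stdSimplex_mulVec_nonpos
    (Matrix.of fun ζ η : Config S N => generator r d (Pi.single ζ 1) η) (by
      intro F _
      -- Maximum principle: the generator is nonpositive where `F` is maximal.
      obtain ⟨η, hη⟩ := Finite.exists_max F
      refine ⟨η, ?_⟩
      simp only [vecMul, dotProduct, of_apply, ← generator_eq_sum_apply_single]
      refine Finset.sum_nonpos fun x _ => Finset.sum_nonpos fun y hy => ?_
      exact mul_nonpos_of_nonneg_of_nonpos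
        (rate_nonneg hr hd η (Finset.ne_of_mem_erase hy).symm) (sub_nonpos.2 (hη _)))
  have hone : ∀ η : Config S N, ∑ ζ, generator r d (Pi.single ζ 1) η = 0 := by
    intro η
    simpa [generator] using (generator_eq_sum_apply_single (r := r) (d := d) 1 η).symm
  have hle' : ∀ ζ, ∑ η, generator r d (Pi.single ζ 1) η * m η ≤ 0 := fun ζ => hle ζ
  have hzero : ∀ ζ, ∑ η, generator r d (Pi.single ζ 1) η * m η = 0 := by
    have htot : ∑ ζ, ∑ η, generator r d (Pi.single ζ 1) η * m η = 0 := by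
      rw [Finset.sum_comm]
      simp [← Finset.sum_mul, hone]
    intro ζ
    exact (Finset.sum_eq_zero_iff_of_nonpos fun ζ _ => hle' ζ).1 htot ζ (Finset.mem_univ ζ)
  refine ⟨m, hm, fun F => ?_⟩
  calc ∑ η, m η * generator r d F η
      = ∑ η, ∑ ζ, F ζ * (generator r d (Pi.single ζ 1) η * m η) := by
        refine Finset.sum_congr rfl fun η _ => ?_
        rw [generator_eq_sum_apply_single F, Finset.mul_sum]
        exact Finset.sum_congr rfl fun ζ _ => by ring
    _ = 0 := by
        rw [Finset.sum_comm]
        simp [← Finset.mul_sum, hzero]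

/-- Irreducibility in terms of measures: the zero set of a nonnegative invariant vector is closed
under time-reversed jumps. -/
theorem eq_zero_of_invariant_of_apply_eq_zero (hr : ∀ x y : S, x ≠ y → 0 < r x y)
    (hd : 0 < d) {m : Config S N → ℝ} (hm : 0 ≤ m)
    (hinv : ∀ F : Config S N → ℝ, ∑ η, m η * generator r d F η = 0)
    {η : Config S N} (hη : m η = 0) : m = 0 := by
  funext ζ
  refine mem_of_closed_under_move (Z := {η | m η = 0}) ?_ hη ζ
  intro ξ hξ x y hxy hx
  rw [Set.mem_ofPred_eq] at hξ ⊢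
  have hterm : ∀ ω : Config S N, ω ≠ ξ → ∀ a b : S, b ∈ Finset.univ.erase a →
      0 ≤ (ω.1 a : ℝ) * (d + (ω.1 b : ℝ)) * r a b *
        ((Pi.single ξ 1 : Config S N → ℝ) (move a b ω) - (Pi.single ξ 1 : Config S N → ℝ) ω) := by
    intro ω hω a b hb
    refine mul_nonneg (rate_nonneg hr hd ω (Finset.ne_of_mem_erase hb).symm) ?_
    rw [Pi.single_eq_of_ne hω, sub_zero]
    by_cases h : move a b ω = ξ <;> simp [h]
  have hnonneg : ∀ ω ∈ Finset.univ, 0 ≤ m ω * generator r d (Pi.single ξ 1) ω := by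
    intro ω _
    by_cases hω : ω = ξ
    · simp [hω, hξ]
    · exact mul_nonneg (hm ω) (Finset.sum_nonneg fun a _ => Finset.sum_nonneg fun b hb =>
        hterm ω hω a b hb)
  have hzero := (Finset.sum_eq_zero_iff_of_nonneg hnonneg).1 (hinv (Pi.single ξ 1))
    (move x y ξ) (Finset.mem_univ _)
  refine (mul_eq_zero.1 hzero).resolve_right (ne_of_gt ?_)
  have hval := move_val hxy hx
  have hne : move x y ξ ≠ ξ := by
    intro h
    have := hval y
    rw [h, if_neg hxy.symm, if_pos rfl] at this
    omega
  have hxmem : x ∈ Finset.univ.erase y := Finset.mem_erase.2 ⟨hxy, Finset.mem_univ x⟩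
  refine Finset.sum_pos' (fun a _ => Finset.sum_nonneg fun b hb => hterm _ hne a b hb)
    ⟨y, Finset.mem_univ y, ?_⟩
  refine Finset.sum_pos' (fun b hb => hterm _ hne y b hb) ⟨x, hxmem, ?_⟩
  rw [move_move hxy hx, Pi.single_eq_same, Pi.single_eq_of_ne hne, hval y, if_neg hxy.symm,
    if_pos rfl]
  have := hr y x hxy.symm
  push_cast
  positivity

theorem IsInvariantProbability.eq (hr : ∀ x y : S, x ≠ y → 0 < r x y)
    (hd : 0 < d) {m m' : Config S N → ℝ} (hm : IsInvariantProbability r d m)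
    (hm' : IsInvariantProbability r d m') : m = m' := by
  have hpos : ∀ η, 0 < m' η := by
    intro η
    refine (hm'.1.1 η).lt_of_ne fun h => ?_
    have h0 := eq_zero_of_invariant_of_apply_eq_zero hr hd hm'.1.1 hm'.2 h.symm
    simpa [h0] using hm'.1.2
  have hne : Nonempty (Config S N) := by
    by_contra h
    rw [not_nonempty_iff] at h
    simpa using hm.1.2
  -- Subtract the largest multiple of `m'` that leaves a nonnegative vector.
  obtain ⟨η, hη⟩ := Finite.exists_min fun η => m η / m' η
  set c := m η / m' η with hc
  have h0 := eq_zero_of_invariant_of_apply_eq_zero hr hd (m := m - c • m')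
    (by
      intro ζ
      have := (le_div_iff₀ (hpos ζ)).1 (hη ζ)
      simpa using this)
    (by
      intro F
      have h1 := hm.2 F
      have h2 := hm'.2 F
      calc ∑ ζ, (m - c • m') ζ * generator r d F ζ
          = ∑ ζ, m ζ * generator r d F ζ - c * ∑ ζ, m' ζ * generator r d F ζ := by
            rw [Finset.mul_sum, ← Finset.sum_sub_distrib]
            exact Finset.sum_congr rfl fun ζ _ => by simp; ring
        _ = 0 := by rw [h1, h2]; simp)
    (η := η) (by simp [hc, div_mul_cancel₀ _ (hpos η).ne'])
  have hmc : m = c • m' := sub_eq_zero.1 h0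
  have hc1 : c = 1 := by
    have h1 := hm.1.2
    rw [hmc] at h1
    simpa [← Finset.mul_sum, hm'.1.2] using h1
  rw [hmc, hc1, one_smul]

end Generator

/-! ### The Lyapunov function -/

/-- The occupied sites of a configuration. -/
def occupied {S : Type*} [Fintype S] (η : S → ℕ) : Finset S :=
  Finset.univ.filter fun x => 1 ≤ η x

theorem mem_occupied {S : Type*} [Fintype S] {η : S → ℕ} {x : S} :
    x ∈ occupied η ↔ 1 ≤ η x := by
  simp [occupied]

/-- The harmonic sum `1 + 1/2 + ⋯ + 1/(n - 1)`, a discrete logarithm; it is `0` at `n = 0`. -/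
noncomputable def harmonicPred (n : ℕ) : ℝ :=
  ∑ k ∈ Finset.range (n - 1), ((k : ℝ) + 1)⁻¹

theorem harmonicPred_nonneg (n : ℕ) : 0 ≤ harmonicPred n :=
  Finset.sum_nonneg fun _ _ => by positivity

theorem harmonicPred_le (n : ℕ) : harmonicPred n ≤ n := by
  calc harmonicPred n ≤ ∑ _k ∈ Finset.range (n - 1), (1 : ℝ) :=
        Finset.sum_le_sum fun k _ => inv_le_one_of_one_le₀ (by linarith [k.cast_nonneg (α := ℝ)])
    _ ≤ n := by simp

theorem harmonicPred_succ {n : ℕ} (hn : 1 ≤ n) :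
    harmonicPred (n + 1) = harmonicPred n + (n : ℝ)⁻¹ := by
  obtain ⟨k, rfl⟩ : ∃ k, n = k + 1 := ⟨n - 1, by omega⟩
  simp [harmonicPred, Finset.sum_range_succ]

/-- The Lyapunov function attached to a choice `p B` of weights for every set `B` of occupied
sites. Among configurations with a fixed set of occupied sites it is a weighted sum of discrete
logarithms; the term `(N + 2)` per occupied site makes it drop whenever a site is emptied. -/
noncomputable def potential (p : Finset S → S → ℝ) (η : Config S N) : ℝ :=
  ∑ x, p (occupied η.1) x * harmonicPred (η.1 x) + (occupied η.1).card * ((N : ℝ) + 2)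

section Potential

variable {p : Finset S → S → ℝ}

theorem weighted_sum_mem_Icc {S : Type*} [Fintype S] {N : ℕ} {w : S → ℝ}
    (hw : w ∈ stdSimplex ℝ S) (η : Config S N) :
    ∑ x, w x * harmonicPred (η.1 x) ∈ Set.Icc 0 (N : ℝ) := by
  refine ⟨Finset.sum_nonneg fun x _ => mul_nonneg (hw.1 x) (harmonicPred_nonneg _), ?_⟩
  calc ∑ x, w x * harmonicPred (η.1 x) ≤ ∑ x, w x * N :=
        Finset.sum_le_sum fun x _ => mul_le_mul_of_nonneg_left
          ((harmonicPred_le _).trans (Nat.cast_le.2 (η.apply_le x))) (hw.1 x)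
    _ = N := by rw [← Finset.sum_mul, hw.2, one_mul]

theorem occupied_nonempty {S : Type*} [Fintype S] {N : ℕ} (hN : 1 ≤ N) (η : Config S N) :
    (occupied η.1).Nonempty := by
  by_contra h
  rw [Finset.not_nonempty_iff_eq_empty] at h
  have hz : ∀ x, η.1 x = 0 := fun x => by
    by_contra hx
    have : x ∈ occupied η.1 := mem_occupied.2 (Nat.one_le_iff_ne_zero.2 hx)
    simp [h] at this
  have := η.2
  simp [hz] at this
  omega

theorem potential_mem_Icc {S : Type*} [Fintype S] {N : ℕ} {p : Finset S → S → ℝ}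
    (hp : ∀ B : Finset S, B.Nonempty → p B ∈ stdSimplex ℝ S)
    (hN : 1 ≤ N) (η : Config S N) :
    potential p η ∈ Set.Icc 0 (N + Fintype.card S * ((N : ℝ) + 2)) := by
  obtain ⟨h0, h1⟩ := weighted_sum_mem_Icc (hp _ (occupied_nonempty hN η)) η
  refine ⟨add_nonneg h0 (by positivity), add_le_add h1 ?_⟩
  gcongr
  exact Finset.card_le_univ _

/-- The contribution of a jump between occupied sites to the drift of the potential at diffusion
parameter `0`. For jumps that keep `x` occupied, the second order correction `η x / (η x - 1) - 1`
is at least `1 / N`. -/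
theorem mul_potential_move_sub_le (hp : ∀ B : Finset S, B.Nonempty → p B ∈ stdSimplex ℝ S)
    (hp0 : ∀ B : Finset S, B.Nonempty → ∀ x ∉ B, p B x = 0)
    (hN : 1 ≤ N) (η : Config S N) {x y : S} (hxy : x ≠ y) :
    (η.1 x : ℝ) * η.1 y * (potential p (move x y η) - potential p η) ≤
      p (occupied η.1) y * η.1 x - p (occupied η.1) x * η.1 y
        - p (occupied η.1) x * η.1 y / N := by
  have hB := occupied_nonempty hN η
  have hpx := (hp _ hB).1 x
  have hpy := (hp _ hB).1 y
  have hpx1 : p (occupied η.1) x ≤ 1 := by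
    rw [← (hp _ hB).2]
    exact Finset.single_le_sum (fun z _ => (hp _ hB).1 z) (Finset.mem_univ x)
  have hN0 : (1 : ℝ) ≤ N := by exact_mod_cast hN
  by_cases hx : 1 ≤ η.1 x
  swap
  · have h1 := hp0 _ hB x (mt mem_occupied.1 hx)
    have h2 : η.1 x = 0 := by omega
    simp [h1, h2]
  by_cases hy : 1 ≤ η.1 y
  swap
  · have h1 := hp0 _ hB y (mt mem_occupied.1 hy)
    have h2 : η.1 y = 0 := by omega
    simp [h1, h2]
  have hval := move_val hxy hx
  have hy' : (1 : ℝ) ≤ η.1 y := by exact_mod_cast hy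
  by_cases hx2 : 2 ≤ η.1 x
  · have hocc : occupied (move x y η).1 = occupied η.1 := by
      ext z
      rw [mem_occupied, mem_occupied, hval]
      split_ifs <;> grind
    have hdiff : potential p (move x y η) - potential p η
        = p (occupied η.1) y * (η.1 y : ℝ)⁻¹ - p (occupied η.1) x * ((η.1 x : ℝ) - 1)⁻¹ := by
      rw [potential, potential, hocc, add_sub_add_right_eq_sub, ← Finset.sum_sub_distrib,
        Finset.sum_eq_add x y hxy (by
          intro z _ hz
          rw [hval, if_neg hz.1, if_neg hz.2, sub_self]) (by simp) (by simp)]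
      rw [hval, hval, if_pos rfl, if_neg hxy.symm, if_pos rfl, harmonicPred_succ hy]
      have h1 := harmonicPred_succ (n := η.1 x - 1) (by omega)
      rw [Nat.sub_add_cancel hx, Nat.cast_sub hx, Nat.cast_one] at h1
      rw [h1]
      ring
    have hx2' : (2 : ℝ) ≤ η.1 x := by exact_mod_cast hx2
    have hxN : (η.1 x : ℝ) ≤ N := Nat.cast_le.2 (η.apply_le x)
    have hfrac : 1 + 1 / (N : ℝ) ≤ (η.1 x : ℝ) * ((η.1 x : ℝ) - 1)⁻¹ := by
      have h1 : (η.1 x : ℝ) * ((η.1 x : ℝ) - 1)⁻¹ = 1 + 1 / ((η.1 x : ℝ) - 1) := by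
        have : (η.1 x : ℝ) - 1 ≠ 0 := by linarith
        field_simp
        ring
      rw [h1]
      have := one_div_le_one_div_of_le (by linarith : 0 < (η.1 x : ℝ) - 1)
        (by linarith : (η.1 x : ℝ) - 1 ≤ N)
      linarith
    have hmul := mul_le_mul_of_nonneg_left hfrac
      (mul_nonneg hpx (by linarith : (0 : ℝ) ≤ η.1 y))
    rw [hdiff]
    have hcancel : (η.1 y : ℝ) * (η.1 y : ℝ)⁻¹ = 1 := mul_inv_cancel₀ (by linarith)
    calc (η.1 x : ℝ) * η.1 y * (p (occupied η.1) y * (η.1 y : ℝ)⁻¹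
          - p (occupied η.1) x * ((η.1 x : ℝ) - 1)⁻¹)
        = p (occupied η.1) y * η.1 x * ((η.1 y : ℝ) * (η.1 y : ℝ)⁻¹)
          - p (occupied η.1) x * η.1 y * ((η.1 x : ℝ) * ((η.1 x : ℝ) - 1)⁻¹) := by ring
      _ ≤ p (occupied η.1) y * η.1 x
          - p (occupied η.1) x * η.1 y * (1 + 1 / (N : ℝ)) := by
        rw [hcancel, mul_one]
        linarith
      _ = _ := by ring
  · have hx1 : η.1 x = 1 := by omega
    have hocc : occupied (move x y η).1 = (occupied η.1).erase x := by
      ext z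
      rw [Finset.mem_erase, mem_occupied, mem_occupied, hval]
      split_ifs <;> grind
    have hcard : ((occupied (move x y η).1).card : ℝ) + 1 = (occupied η.1).card := by
      rw [hocc]
      exact_mod_cast Finset.card_erase_add_one (mem_occupied.2 hx)
    have h1 := (weighted_sum_mem_Icc (hp _ hB) η).1
    have h2 := (weighted_sum_mem_Icc (hp _ (occupied_nonempty hN (move x y η)))
      (move x y η)).2
    have hdiff : potential p (move x y η) - potential p η ≤ -2 := by
      rw [potential, potential, ← hcard]
      linarith
    have hdiv : p (occupied η.1) x * η.1 y / N ≤ p (occupied η.1) x * η.1 y :=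
      div_le_self (by positivity) hN0
    have h3 : p (occupied η.1) x * η.1 y ≤ η.1 y := mul_le_of_le_one_left (by positivity) hpx1
    have h4 := mul_le_mul_of_nonneg_left hdiff (by positivity : (0 : ℝ) ≤ η.1 y)
    rw [hx1, Nat.cast_one, one_mul, mul_one]
    linarith

end Potential

/-! ### Drift estimates and condensation -/

theorem mem_condensed {η : Config S N} : η ∈ condensed S N ↔ ∃ x, η.1 x = N := by
  simp [condensed]

/-- The part of the generator with diffusion parameter `0` is absorbed in the condensed
configurations: there at most one site is occupied. -/
theorem mul_eq_zero_of_mem_condensed {η : Config S N} (hη : η ∈ condensed S N) {x y : S}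
    (hxy : x ≠ y) : (η.1 x : ℝ) * η.1 y = 0 := by
  obtain ⟨z, hz⟩ := mem_condensed.1 hη
  have key : ∀ w, w ≠ z → η.1 w = 0 := by
    intro w hw
    have h1 := η.2
    rw [← Finset.add_sum_erase _ _ (Finset.mem_univ z), hz] at h1
    have h2 : ∑ v ∈ Finset.univ.erase z, η.1 v = 0 := by omega
    exact Finset.sum_eq_zero_iff.1 h2 w (Finset.mem_erase.2 ⟨hw, Finset.mem_univ w⟩)
  by_cases hxz : x = z
  · rw [key y (by rintro rfl; exact hxy hxz), Nat.cast_zero, mul_zero]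
  · rw [key x hxz, Nat.cast_zero, zero_mul]

/-- At a configuration that is not condensed, the potential built from optimal strategies has
drift at most `-c / N` at diffusion parameter `0`. The first order drift is nonpositive by
optimality, and the second order correction is negative. -/
theorem sum_drift_potential_le {r : S → S → ℝ} {c : ℝ} (hc : 0 < c)
    (hr : ∀ x y : S, x ≠ y → c ≤ r x y) {p : Finset S → S → ℝ}
    (hp : ∀ B : Finset S, B.Nonempty → p B ∈ stdSimplex ℝ S)
    (hp0 : ∀ B : Finset S, B.Nonempty → ∀ x ∉ B, p B x = 0)
    (hopt : ∀ B : Finset S, B.Nonempty → ∀ x ∈ B, ∑ y, (r x y - r y x) * p B y ≤ 0)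
    (hN : 1 ≤ N) {η : Config S N} (hη : η ∉ condensed S N) :
    ∑ x, ∑ y ∈ Finset.univ.erase x,
      (η.1 x : ℝ) * η.1 y * r x y * (potential p (move x y η) - potential p η) ≤ -(c / N) := by
  have hB := occupied_nonempty hN η
  set q := p (occupied η.1) with hq
  have hN0 : (0 : ℝ) < N := by exact_mod_cast hN
  have hterm : ∀ x, ∀ y ∈ Finset.univ.erase x,
      (η.1 x : ℝ) * η.1 y * r x y * (potential p (move x y η) - potential p η)
        ≤ r x y * (q y * η.1 x - q x * η.1 y) - c / N * (q x * η.1 y) := by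
    intro x y hy
    have hxy : x ≠ y := (Finset.ne_of_mem_erase hy).symm
    have h1 := mul_le_mul_of_nonneg_left (mul_potential_move_sub_le hp hp0 hN η hxy)
      (hc.le.trans (hr x y hxy))
    have h2 : 0 ≤ q x * η.1 y / N :=
      div_nonneg (mul_nonneg ((hp _ hB).1 x) (Nat.cast_nonneg _)) hN0.le
    have h3 := mul_le_mul_of_nonneg_right (hr x y hxy) h2
    calc _ = r x y * ((η.1 x : ℝ) * η.1 y * (potential p (move x y η) - potential p η)) := by ring
      _ ≤ r x y * (q y * η.1 x - q x * η.1 y - q x * η.1 y / N) := h1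
      _ ≤ r x y * (q y * η.1 x - q x * η.1 y) - c * (q x * η.1 y / N) := by linarith
      _ = _ := by ring
  have hfirst : ∑ x, ∑ y ∈ Finset.univ.erase x, r x y * (q y * η.1 x - q x * η.1 y) ≤ 0 := by
    have hdiag : ∀ x, ∑ y ∈ Finset.univ.erase x, r x y * (q y * η.1 x - q x * η.1 y)
        = ∑ y, r x y * (q y * η.1 x - q x * η.1 y) := by
      intro x
      exact Finset.sum_erase _ (by rw [sub_self, mul_zero])
    simp only [hdiag]
    have hswap : ∑ x, ∑ y, r x y * (q y * η.1 x - q x * η.1 y)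
        = ∑ x, (η.1 x : ℝ) * ∑ y, (r x y - r y x) * q y := by
      have h1 : ∑ x, ∑ y, r x y * (q x * η.1 y) = ∑ x, ∑ y, r y x * (q y * η.1 x) :=
        Finset.sum_comm
      simp only [mul_sub, Finset.sum_sub_distrib]
      rw [h1, ← Finset.sum_sub_distrib]
      refine Finset.sum_congr rfl fun x _ => ?_
      rw [← Finset.sum_sub_distrib, Finset.mul_sum]
      exact Finset.sum_congr rfl fun y _ => by ring
    rw [hswap]
    refine Finset.sum_nonpos fun x _ => ?_
    by_cases hx : 1 ≤ η.1 x
    · exact mul_nonpos_of_nonneg_of_nonpos (Nat.cast_nonneg _)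
        (hopt _ hB x (mem_occupied.2 hx))
    · have : η.1 x = 0 := by omega
      simp [this]
  have hsecond : 1 ≤ ∑ x, ∑ y ∈ Finset.univ.erase x, q x * (η.1 y : ℝ) := by
    rw [← (hp _ hB).2]
    refine Finset.sum_le_sum fun x _ => ?_
    rw [← Finset.mul_sum]
    refine le_mul_of_one_le_right ((hp _ hB).1 x) ?_
    have h1 := η.2
    rw [← Finset.add_sum_erase _ _ (Finset.mem_univ x)] at h1
    have h2 : η.1 x ≠ N := fun h => hη (mem_condensed.2 ⟨x, h⟩)
    have h3 : 1 ≤ ∑ y ∈ Finset.univ.erase x, η.1 y := by omega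
    exact_mod_cast h3
  calc _ ≤ ∑ x, ∑ y ∈ Finset.univ.erase x,
        (r x y * (q y * η.1 x - q x * η.1 y) - c / N * (q x * η.1 y)) :=
        Finset.sum_le_sum fun x _ => Finset.sum_le_sum fun y hy => hterm x y hy
    _ = ∑ x, ∑ y ∈ Finset.univ.erase x, r x y * (q y * η.1 x - q x * η.1 y)
        - c / N * ∑ x, ∑ y ∈ Finset.univ.erase x, q x * (η.1 y : ℝ) := by
        simp only [Finset.sum_sub_distrib, Finset.mul_sum]
    _ ≤ 0 - c / N * 1 :=
        sub_le_sub hfirst (mul_le_mul_of_nonneg_left hsecond (div_pos hc hN0).le)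
    _ = -(c / N) := by ring

/-- Quantitative condensation: the mass outside the condensed configurations is `O(d N ^ 3)`, with
a constant that depends only on the rates `r`. -/
theorem exists_one_sub_condensed_le (r : S → S → ℝ) (hr : ∀ x y : S, x ≠ y → 0 < r x y) :
    ∃ C : ℝ, ∀ (N : ℕ) (d : ℝ) (m : Config S N → ℝ), 1 ≤ N → 0 < d →
      IsInvariantProbability r d m → 1 - ∑ η ∈ condensed S N, m η ≤ C * (d * (N : ℝ) ^ 3) := by
  obtain ⟨c, hc, hcr⟩ : ∃ c : ℝ, 0 < c ∧ ∀ x y : S, x ≠ y → c ≤ r x y := by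
    have hfin : ∃ c : ℝ, 0 < c ∧ ∀ z : {z : S × S // z.1 ≠ z.2}, c ≤ r z.1.1 z.1.2 := by
      rcases isEmpty_or_nonempty {z : S × S // z.1 ≠ z.2} with h | h
      · exact ⟨1, one_pos, fun z => h.elim z⟩
      · obtain ⟨z, hz⟩ := Finite.exists_min fun z : {z : S × S // z.1 ≠ z.2} => r z.1.1 z.1.2
        exact ⟨_, hr _ _ z.2, hz⟩
    obtain ⟨c, hc, h⟩ := hfin
    exact ⟨c, hc, fun x y hxy => h ⟨(x, y), hxy⟩⟩
  choose! p hp hp0 hopt using exists_optimal_strategy r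
  set R : ℝ := ∑ x, ∑ y ∈ Finset.univ.erase x, r x y with hR
  clear_value R
  have hrx : ∀ x, ∀ y ∈ Finset.univ.erase x, 0 ≤ r x y := fun x y hy =>
    (hr x y (Finset.ne_of_mem_erase hy).symm).le
  have hR0 : 0 ≤ R := hR ▸ Finset.sum_nonneg fun x _ => Finset.sum_nonneg fun y hy => hrx x y hy
  refine ⟨R * (1 + 3 * Fintype.card S) / c, fun N d m hN hd hm => ?_⟩
  have hN1 : (1 : ℝ) ≤ N := by exact_mod_cast hN
  have hN0 : (0 : ℝ) < N := by linarith
  set T : ℝ := N + Fintype.card S * ((N : ℝ) + 2) with hT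
  have hT0 : 0 ≤ T := by positivity
  have hTN : T ≤ (1 + 3 * Fintype.card S) * N := by
    have : (Fintype.card S : ℝ) * ((N : ℝ) + 2) ≤ Fintype.card S * (3 * N) := by
      gcongr
      linarith
    linarith
  have hgen : ∀ η : Config S N, generator r d (potential p) η
      ≤ d * N * (R * T) - c / N * (if η ∈ condensed S N then 0 else 1) := by
    intro η
    have hsplit : generator r d (potential p) η
        = ∑ x, ∑ y ∈ Finset.univ.erase x,
            d * η.1 x * (r x y * (potential p (move x y η) - potential p η))
          + ∑ x, ∑ y ∈ Finset.univ.erase x,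
            (η.1 x : ℝ) * η.1 y * r x y * (potential p (move x y η) - potential p η) := by
      simp only [generator, ← Finset.sum_add_distrib]
      exact Finset.sum_congr rfl fun x _ => Finset.sum_congr rfl fun y _ => by ring
    have hdiffusion : ∑ x, ∑ y ∈ Finset.univ.erase x,
        d * η.1 x * (r x y * (potential p (move x y η) - potential p η)) ≤ d * N * (R * T) := by
      rw [hR, Finset.sum_mul, Finset.mul_sum]
      refine Finset.sum_le_sum fun x _ => ?_
      rw [Finset.sum_mul, Finset.mul_sum]
      refine Finset.sum_le_sum fun y hy => ?_
      have h1 := (potential_mem_Icc hp hN (move x y η)).2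
      have h2 := (potential_mem_Icc hp hN η).1
      have h3 : (η.1 x : ℝ) ≤ N := Nat.cast_le.2 (η.apply_le x)
      have h4 := hrx x y hy
      calc _ ≤ d * η.1 x * (r x y * T) := by
            gcongr
            linarith
        _ ≤ d * N * (r x y * T) := by gcongr
    rw [hsplit]
    split_ifs with hη
    · have hzero : ∑ x, ∑ y ∈ Finset.univ.erase x,
          (η.1 x : ℝ) * η.1 y * r x y * (potential p (move x y η) - potential p η) = 0 :=
        Finset.sum_eq_zero fun x _ => Finset.sum_eq_zero fun y hy => by
          rw [mul_eq_zero_of_mem_condensed hη (Finset.ne_of_mem_erase hy).symm, zero_mul, zero_mul]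
      rw [hzero]
      linarith
    · have := sum_drift_potential_le hc hcr hp hp0 hopt hN hη
      linarith
  have hmass : ∑ η, m η * (if η ∈ condensed S N then (0 : ℝ) else 1)
      = 1 - ∑ η ∈ condensed S N, m η := by
    have h := Finset.sum_ite_mem Finset.univ (condensed S N) m
    rw [Finset.univ_inter] at h
    refine eq_sub_of_add_eq ?_
    rw [← h, ← Finset.sum_add_distrib]
    refine Eq.trans (Finset.sum_congr rfl fun η _ => ?_) hm.1.2
    split_ifs <;> simp
  have hbalance : 0 ≤ d * N * (R * T) - c / N * (1 - ∑ η ∈ condensed S N, m η) := by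
    rw [← hm.2 (potential p), ← hmass]
    calc _ ≤ ∑ η, m η * (d * N * (R * T) - c / N * (if η ∈ condensed S N then 0 else 1)) :=
          Finset.sum_le_sum fun η _ => mul_le_mul_of_nonneg_left (hgen η) (hm.1.1 η)
      _ = (∑ η, m η) * (d * N * (R * T))
          - c / N * ∑ η, m η * (if η ∈ condensed S N then (0 : ℝ) else 1) := by
          rw [Finset.sum_mul, Finset.mul_sum, ← Finset.sum_sub_distrib]
          exact Finset.sum_congr rfl fun η _ => by ring
      _ = _ := by rw [hm.1.2, one_mul]
  have hRT : d * N * (R * T) ≤ d * N * (R * ((1 + 3 * Fintype.card S) * N)) := by gcongr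
  calc 1 - ∑ η ∈ condensed S N, m η
      = N / c * (c / N * (1 - ∑ η ∈ condensed S N, m η)) := by field_simp
    _ ≤ N / c * (d * N * (R * ((1 + 3 * Fintype.card S) * N))) :=
        mul_le_mul_of_nonneg_left (by linarith) (by positivity)
    _ = _ := by ring

theorem sum_condensed_of_card_eq_one {S : Type*} [Fintype S] [DecidableEq S] {N : ℕ}
    (hS : Fintype.card S = 1) {m : Config S N → ℝ} (hm : m ∈ stdSimplex ℝ (Config S N)) :
    ∑ η ∈ condensed S N, m η = 1 := by
  obtain ⟨a, ha⟩ := Fintype.card_eq_one_iff.1 hS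
  have : condensed S N = Finset.univ := by
    refine Finset.eq_univ_of_forall fun η => mem_condensed.2 ⟨a, ?_⟩
    have h := η.2
    rwa [Finset.sum_eq_single a (fun b _ hb => absurd (ha b) hb) (by simp)] at h
  rw [this, hm.2]

end InclusionProcess

/-- For at least two sites the hypothesis on `d` is stronger than `d N * N ^ 3 → 0`. -/
theorem tendsto_mul_cube_of_tendsto {k : ℕ} (hk : 2 ≤ k) {d : ℕ → ℝ}
    (hd : ∀ N : ℕ, 1 ≤ N → 0 < d N)
    (hlim : Tendsto (fun N : ℕ => d N * (N : ℝ) ^ (k + 2) * Real.log (N : ℝ) ^ ((k : ℤ) - 3))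
      atTop (𝓝 0)) :
    Tendsto (fun N : ℕ => d N * (N : ℝ) ^ 3) atTop (𝓝 0) := by
  refine squeeze_zero' ?_ ?_ hlim
  · filter_upwards [eventually_ge_atTop 1] with N hN
    have := hd N hN
    positivity
  · filter_upwards [eventually_ge_atTop 3] with N hN
    have hdN := hd N (by omega)
    have hN3 : (3 : ℝ) ≤ N := by exact_mod_cast hN
    have hlog : 1 ≤ Real.log N := by
      rw [Real.le_log_iff_exp_le (by linarith)]
      linarith [Real.exp_one_lt_three]
    have hlogN : Real.log N ≤ N := Real.log_le_self (by linarith)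
    -- The power of the logarithm is negative only for `k = 2`.
    have hpow : (Real.log N)⁻¹ ≤ Real.log N ^ ((k : ℤ) - 3) := by
      rw [← zpow_neg_one]
      exact zpow_le_zpow_right₀ hlog (by omega)
    have hinv : (N : ℝ)⁻¹ ≤ (Real.log N)⁻¹ := inv_anti₀ (by linarith) hlogN
    calc d N * (N : ℝ) ^ 3 = d N * (N : ℝ) ^ 4 * (N : ℝ)⁻¹ := by field_simp
      _ ≤ d N * (N : ℝ) ^ (k + 2) * Real.log N ^ ((k : ℤ) - 3) := by
        gcongr
        · linarith
        · omega
        · exact hinv.trans hpow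

theorem theorem3p11 {S : Type*} [Fintype S] [DecidableEq S] [Nonempty S]
    (r : S → S → ℝ) (hUP : ∀ x y : S, x ≠ y → 0 < r x y)
    (d : ℕ → ℝ) (hd : ∀ N : ℕ, 1 ≤ N → 0 < d N)
    (hlim : Tendsto
      (fun N : ℕ => d N * (N : ℝ) ^ (Fintype.card S + 2)
        * Real.log (N : ℝ) ^ ((Fintype.card S : ℤ) - 3)) atTop (𝓝 0)) :
    (∀ N : ℕ, 1 ≤ N →
      ∃! m : InclusionProcess.Config S N → ℝ,
        InclusionProcess.IsInvariantProbability r (d N) m) ∧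
    ∀ μ : (N : ℕ) → InclusionProcess.Config S N → ℝ,
      (∀ N : ℕ, 1 ≤ N → InclusionProcess.IsInvariantProbability r (d N) (μ N)) →
      Tendsto (fun N : ℕ => ∑ η ∈ InclusionProcess.condensed S N, μ N η) atTop (𝓝 1) := by
  refine ⟨fun N hN => ?_, fun μ hμ => ?_⟩
  · obtain ⟨m, hm⟩ := InclusionProcess.exists_isInvariantProbability (N := N) hUP (hd N hN)
    exact ⟨m, hm, fun m' hm' => hm'.eq hUP (hd N hN) hm⟩
  · rcases (Nat.succ_le_of_lt (Fintype.card_pos (α := S))).eq_or_lt with hS | hS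
    · refine tendsto_const_nhds.congr' ?_
      filter_upwards [eventually_ge_atTop 1] with N hN
      exact (InclusionProcess.sum_condensed_of_card_eq_one hS.symm (hμ N hN).1).symm
    · obtain ⟨C, hC⟩ := InclusionProcess.exists_one_sub_condensed_le r hUP
      have hcube := (tendsto_mul_cube_of_tendsto hS hd hlim).const_mul C
      rw [mul_zero] at hcube
      refine tendsto_of_tendsto_of_tendsto_of_le_of_le' (by simpa using hcube.const_sub 1)
        tendsto_const_nhds ?_ ?_
      · filter_upwards [eventually_ge_atTop 1] with N hN
        linarith [hC N (d N) (μ N) hN (hd N hN) (hμ N hN)]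
      · filter_upwards [eventually_ge_atTop 1] with N hN
        rw [← (hμ N hN).1.2]
        exact Finset.sum_le_univ_sum_of_nonneg (hμ N hN).1.1
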